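/- Let $(X,d)$ and $(Y,d_Y)$ be compact metric spaces and let $f_y:X\to X$, $y\in Y$, be continuous maps generating the free semigroup action $G$. For a word $w=i_1\cdots i_n\in Y^n$ write $f_w=f_{i_1}\circ\cdots\circ f_{i_n}$ ($f_\emptyset=\mathrm{id}$), $\overline w=i_n\cdots i_1$, and $$d_w(x_1,x_2)=\max_{0\le j\le n}d\big(f_{i_j\cdots i_1}(x_1),f_{i_j\cdots i_1}(x_2)\big),\qquad B_w(x,\delta)=\{y\in X: d_w(x,y)<\delta\}.$$ For $\omega=(i_1i_2\cdots)\in Y^{\mathbb N}$ let $\omega|_{[1,n]}=i_1\cdots i_n$. $G$ has the gluing orbit property if for every $\varepsilon>0$ there is an integer $\mathfrak p(\varepsilon)>0$ such that for all $k\ge 2$, all $x_1,\dots,x_k\in X$, all $n_1,\dots,n_k\ge 1$ and all words $w_j\in Y^{n_j}$ $(1\le j\le k)$ there are $0\le p_1,\dots,p_{k-1}\le\mathfrak p(\varepsilon)$ such that for all words $v_j\in Y^{p_j}$ $(1\le j\le k-1)$ $$B_{w_1}(x_1,\varepsilon)\cap\bigcap_{j=2}^k \big(f_{\overline{v_{j-1}}\,\overline{w_{j-1}}\cdots\overline{v_1}\,\overline{w_1}}\big)^{-1}B_{w_j}(x_j,\varepsilon)\ne\emptyset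 .$$ A Borel probability measure $\nu$ on $Y$ is homogeneous if there is $L>0$ with $\nu(B(y_1,2\varepsilon))\le L\,\nu(B(y_2,\varepsilon))$ for all $y_1,y_2\in\operatorname{supp}\nu$ and $\varepsilon>0$. The upper box dimension is $\overline{\dim}_BY=\limsup_{\varepsilon\to0}\log N(\varepsilon)/\log\frac1\varepsilon$, where $N(\varepsilon)$ is the maximal cardinality of an $\varepsilon$-separated subset of $Y$. Put $\mathbb P=\nu^{\mathbb N}$ on $Y^{\mathbb N}$. All dimensions below take values in $[-\infty,\infty]$, and integrals of nonnegative functions over $Y^{\mathbb N}$ are read as lower integrals if measurability fails. Let $s(w,\varepsilon)$ be the maximal cardinality of a subset of $X$ whose distinct points have $d_w$-distance $>\varepsilon$, and $$\overline{\mathrm{mdim}}_M(X,G,d,\mathbb P)=\limsup_{\varepsilon\to0}\frac{1}{-\log\varepsilon}\limsup_{n\to\infty}\frac1n\log\int_{Y^{\mathbb N}}s(\omega|_{[1,n]},\varepsilon)\,d\mathbb P(\omega)$$ (the upper metric mean dimension of the whole action, due to Carvalho et al.). For $Z\subset X$, $w=i_1\cdots i_N\in Y^N$ and $\varepsilon>0$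 let $\Lambda_w(Z,N,\varepsilon)$ be the infimum, over all open covers $\mathcal U$ of $X$ with $\sup_{U\in\mathcal U}\operatorname{diam}U<\varepsilon$ and all countable collections $\mathcal G$ of strings $\mathbf U=(U_0,\dots,U_N)\in\mathcal U^{N+1}$ such that the sets $\{x: f_{i_j\cdots i_1}(x)\in U_j,\ 0\le j\le N\}$, $\mathbf U\in\mathcal G$, cover $Z$, of the cardinality of $\mathcal G$. Put $$\overline{\mathrm{umdim}}_Z(\varepsilon,G,d,\mathbb P)=\inf\Big\{\lambda\in\mathbb R:\ \limsup_{N\to\infty}\int_{Y^{\mathbb N}} e^{-\lambda(N+1)}\Lambda_{\omega|_{[1,N]}}(Z,N,\varepsilon)\,d\mathbb P(\omega)=0\Big\},$$ and let the $u$-upper metric mean dimension of $G$ on $Z$ be $\overline{\mathrm{umdim}}_Z(G,d,\mathbb P)=\limsup_{\varepsilon\to0}\overline{\mathrm{umdim}}_Z(\varepsilon,G,d,\mathbb P)/\log\frac1\varepsilon$. For $m\in\mathbb N$ and a continuous $\varphi:X\to\mathbb R^m$ let $I_\varphi(G)$ be the set of all $x\in X$ for which there is $\omega\in Y^{\mathbb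 N}$ such that $\lim_{n\to\infty}\frac1n\sum_{j=0}^{n-1}\varphi\big(f_{\overline{\omega|_{[1,j]}}}(x)\big)$ does not exist. **Theorem.** Suppose that $G$ has the gluing orbit property, that $\overline{\dim}_BY<\infty$, and that $\nu$ is a homogeneous Borel probability measure on $Y$ with $\operatorname{supp}\nu=Y$. Let $\varphi:X\to\mathbb R^m$ be continuous. If $I_\varphi(G)\neq\emptyset$, then $$\overline{\mathrm{umdim}}_{I_\varphi(G)}(G,d,\mathbb P)=\overline{\mathrm{mdim}}_M(X,G,d,\mathbb P)=\overline{\mathrm{umdim}}_X(G,d,\mathbb P).$$ -/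

import Mathlib

open MeasureTheory Filter Topology

noncomputable section

namespace FreeSemigroup

variable {X Y : Type*}

/-! Words over the alphabet `Y` are lists; an infinite word `ω = (i₁ i₂ ⋯)` is a function `ℕ → Y`
with `i_{j+1} = ω j`. -/

/-- `f_w = f_{i₁} ∘ ⋯ ∘ f_{i_k}` for the word `w = i₁ ⋯ i_k`, and `f_∅ = id`. -/
def wordMap (f : Y → X → X) : List Y → X → X
  | [] => id
  | y :: w => f y ∘ wordMap f w

/-- `ω|_{[1,n]} = i₁ ⋯ i_n`. -/
def firstWord (ω : ℕ → Y) (n : ℕ) : List Y := (List.range n).map ω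

/-- The metric `d_w(x₁, x₂) = max_{w' ≤ w̄} d(f_{w'} x₁, f_{w'} x₂)`, where `w̄` is the reversed word
and `w' ≤ w̄` means that `w'` is a suffix of `w̄` (finitely many, the empty word included). -/
def wordDist [MetricSpace X] (f : Y → X → X) (w : List Y) (x₁ x₂ : X) : ℝ :=
  ⨆ w' : {w' : List Y // w' <:+ w.reverse}, dist (wordMap f w' x₁) (wordMap f w' x₂)

/-- The Bowen ball `B_w(x, δ)`. -/
def bowenBall [MetricSpace X] (f : Y → X → X) (w : List Y) (x : X) (δ : ℝ) : Set X :=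
  {y | wordDist f w x y < δ}

/-- `glueWord w v j` is the word `v̄_{j-1} w̄_{j-1} ⋯ v̄₀ w̄₀`. -/
def glueWord (w v : ℕ → List Y) : ℕ → List Y
  | 0 => []
  | j + 1 => (v j).reverse ++ (w j).reverse ++ glueWord w v j

/-- The gluing orbit property. Finite families `(a₁, …, a_k)` are written as `a 0, …, a (k - 1)`
with `a` a sequence whose other terms play no role. -/
def GluingOrbitProperty [MetricSpace X] (f : Y → X → X) : Prop :=
  ∀ ε : ℝ, 0 < ε → ∃ P : ℕ, 0 < P ∧
    ∀ k : ℕ, 2 ≤ k → ∀ (x : ℕ → X) (w : ℕ → List Y), (∀ j < k, 0 < (w j).length) →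
      ∃ p : ℕ → ℕ, (∀ j < k - 1, p j ≤ P) ∧
        ∀ v : ℕ → List Y, (∀ j < k - 1, (v j).length = p j) →
          (bowenBall f (w 0) (x 0) ε ∩
            ⋂ j ∈ Finset.Ico 1 k,
              wordMap f (glueWord w v j) ⁻¹' bowenBall f (w j) (x j) ε).Nonempty

/-- A homogeneous Borel measure. -/
def IsHomogeneous [MetricSpace Y] [MeasurableSpace Y] (ν : Measure Y) : Prop :=
  ∃ L : NNReal, 0 < L ∧ ∀ y₁ ∈ ν.support, ∀ y₂ ∈ ν.support, ∀ ε : ℝ, 0 < ε →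
    ν (Metric.ball y₁ (2 * ε)) ≤ L * ν (Metric.ball y₂ ε)

/-- The upper box dimension of `Y`; the packing number is the maximal cardinality of an
`ε`-separated set. -/
def upperBoxDim (Y : Type*) [MetricSpace Y] : EReal :=
  limsup (fun ε : ℝ =>
    ENNReal.log (Metric.packingNumber ε.toNNReal (Set.univ : Set Y) : ENNReal) /
      (Real.log (1 / ε) : EReal)) (𝓝[>] 0)

/-- The random walk `ν^ℕ` on `Y^ℕ`. -/
def randomWalk [MeasurableSpace Y] (ν : Measure Y) : Measure (ℕ → Y) :=
  Measure.infinitePi fun _ : ℕ => ν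

section WholeSpace

/-- `s(w, ε, Z, G)`: the maximal cardinality of a subset of `Z` whose distinct points have
`d_w`-distance `> ε`. -/
def sepCard [MetricSpace X] (f : Y → X → X) (w : List Y) (ε : ℝ) (Z : Set X) : ℕ∞ :=
  ⨆ (K : Set X) (_ : K ⊆ Z) (_ : K.Pairwise fun x₁ x₂ => ε < wordDist f w x₁ x₂), K.encard

/-- `h(X, G, ℙ, ε)`. -/
def entropyAt [MetricSpace X] [MeasurableSpace Y] (f : Y → X → X) (ℙ : Measure (ℕ → Y))
    (ε : ℝ) : EReal :=
  limsup (fun n : ℕ =>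
    ENNReal.log (∫⁻ ω, (sepCard f (firstWord ω n) ε Set.univ : ENNReal) ∂ℙ) / (n : EReal)) atTop

/-- The upper metric mean dimension of the action on the whole phase space. -/
def upperMdimM [MetricSpace X] [MeasurableSpace Y] (f : Y → X → X) (ℙ : Measure (ℕ → Y)) :
    EReal :=
  limsup (fun ε : ℝ => entropyAt f ℙ ε / ((-Real.log ε : ℝ) : EReal)) (𝓝[>] 0)

end WholeSpace

section Subsets

/-- `C(ε)`: the open covers of `X` with diameter less than `ε`. -/
def openCovers (X : Type*) [MetricSpace X] (ε : ℝ) : Set (Set (Set X)) :=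
  {𝒰 | (∀ U ∈ 𝒰, IsOpen U) ∧ ⋃₀ 𝒰 = Set.univ ∧ (⨆ U ∈ 𝒰, Metric.ediam U) < ENNReal.ofReal ε}

/-- `X_w(𝐔) = {x : x ∈ U₀, f_{i₁} x ∈ U₁, …, f_{i_N ⋯ i₁} x ∈ U_N}` for `w = i₁ ⋯ i_N` and a
string `𝐔 = (U₀, …, U_N)`. -/
def stringSet (f : Y → X → X) (w : List Y) (U : Fin (w.length + 1) → Set X) : Set X :=
  {x | ∀ j : Fin (w.length + 1), wordMap f (w.take j).reverse x ∈ U j}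

/-- `Λ_w(Z, N, ε, G, d)` with `N = |w|`: the least cardinality of a countable collection of
strings of length `N + 1` over a cover in `C(ε)` whose sets `X_w(𝐔)` cover `Z`. -/
def coverCard [MetricSpace X] (f : Y → X → X) (w : List Y) (ε : ℝ) (Z : Set X) : ℕ∞ :=
  ⨅ (𝒰 ∈ openCovers X ε) (𝒢 : Set (Fin (w.length + 1) → Set X)) (_ : 𝒢.Countable)
    (_ : ∀ U ∈ 𝒢, ∀ j, U j ∈ 𝒰) (_ : Z ⊆ ⋃ U ∈ 𝒢, stringSet f w U), 𝒢.encard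

/-- `R(Z, lam, N, ε, G, d, ℙ)`. -/
def coverSum [MetricSpace X] [MeasurableSpace Y] (f : Y → X → X) (ℙ : Measure (ℕ → Y))
    (Z : Set X) (lam : ℝ) (N : ℕ) (ε : ℝ) : ENNReal :=
  ∫⁻ ω, ENNReal.ofReal (Real.exp (-lam * (N + 1))) *
    (coverCard f (firstWord ω N) ε Z : ENNReal) ∂ℙ

/-- The critical value at scale `ε`: the infimum of the real `lam` with
`limsup_N R(Z, lam, N, ε, G, d, ℙ) = 0`. -/
def upperUmdimAt [MetricSpace X] [MeasurableSpace Y] (f : Y → X → X) (ℙ : Measure (ℕ → Y))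
    (Z : Set X) (ε : ℝ) : EReal :=
  sInf ((fun lam : ℝ => (lam : EReal)) ''
    {lam : ℝ | limsup (fun N : ℕ => coverSum f ℙ Z lam N ε) atTop = 0})

/-- The `u`-upper metric mean dimension of the action on the subset `Z`. -/
def upperUmdim [MetricSpace X] [MeasurableSpace Y] (f : Y → X → X) (ℙ : Measure (ℕ → Y))
    (Z : Set X) : EReal :=
  limsup (fun ε : ℝ => upperUmdimAt f ℙ Z ε / (Real.log (1 / ε) : EReal)) (𝓝[>] 0)

end Subsets

/-- The set `I_φ(G)` of `φ`-irregular points. -/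
def irregularSet {E : Type*} [AddCommGroup E] [Module ℝ E] [TopologicalSpace E]
    (f : Y → X → X) (φ : X → E) : Set X :=
  {x | ∃ ω : ℕ → Y, ¬ ∃ a : E, Tendsto (fun n : ℕ =>
    (1 / (n : ℝ)) • ∑ j ∈ Finset.range n, φ (wordMap f (firstWord ω j).reverse x)) atTop (𝓝 a)}

end FreeSemigroup

end

/-!
The covering numbers merely count strings of one common length, so only finite covers matter. Finite
unions commute with closure, so covering a dense set costs as much as covering `X`, which up to a
constant factor in `ε` is as costly as separating `X` in the metric `d_w`. The critical `λ` at
scale `ε` is the exponential growth rate of the mean covering number, and a constant factor in `ε`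
is invisible after division by `log (1 / ε)`; hence the `u`-upper metric mean dimension of any dense
set is the upper metric mean dimension of the action.

It remains to see that a nonempty irregular set is dense. Given `t : X` and a point `x₀` whose
averages along `ω₀` oscillate, compactness extends the gluing orbit property to infinitely many
pieces, and one glues a piece of the orbit of `t` to pieces of the orbit of `x₀` whose lengths run
through times of oscillation. As the gaps are bounded and each piece can be taken much longer than
everything before it, the averages of the glued point, which is near `t`, oscillate as well.
-/

namespace FreeSemigroupAction

open FreeSemigroup

section GrowthRates

theorem limsup_div_le_of_isEquivalent {α : Type*} {l : Filter α} {h : α → EReal} {a b : α → ℝ}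
    (hab : Asymptotics.IsEquivalent l a b) (ha : ∀ᶠ x in l, 0 < a x) :
    limsup (fun x => h x / (a x : EReal)) l ≤ limsup (fun x => h x / (b x : EReal)) l := by
  rcases l.eq_or_neBot with rfl | _
  · simp only [limsup_bot, le_refl]
  obtain ⟨u, hu, hba⟩ := hab.symm.exists_eq_mul
  refine EReal.le_of_forall_lt_iff_le.1 fun c hc => ?_
  have hlim : Tendsto (fun x => ((c * u x : ℝ) : EReal)) l (𝓝 (c : EReal)) :=
    EReal.tendsto_coe.2 (by simpa only [mul_one] using hu.const_mul c)
  refine le_trans (limsup_le_limsup ?_) hlim.limsup_eq.le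
  filter_upwards [eventually_lt_of_limsup_lt hc, ha, hba, hu.eventually_const_lt zero_lt_one]
    with x hlt hax hbx hux
  have hbpos : 0 < b x := hbx ▸ mul_pos hux hax
  have hle : h x ≤ b x * c :=
    (EReal.div_le_iff_le_mul (EReal.coe_pos.2 hbpos) (EReal.coe_ne_top _)).1 hlt.le
  rw [EReal.div_le_iff_le_mul (EReal.coe_pos.2 hax) (EReal.coe_ne_top _)]
  refine hle.trans_eq ?_
  rw [hbx, Pi.mul_apply, ← EReal.coe_mul, ← EReal.coe_mul]
  congr 1
  ring

theorem tendsto_const_mul_nhdsGT_zero {c : ℝ} (hc : 0 < c) :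
    Tendsto (fun ε : ℝ => c * ε) (𝓝[>] 0) (𝓝[>] 0) :=
  tendsto_iff_comap.2 (comap_mulLeft_nhdsGT_zero hc).ge

theorem isEquivalent_log_log_const_mul {c : ℝ} (hc : 0 < c) :
    Asymptotics.IsEquivalent (𝓝[>] 0) Real.log fun ε => Real.log (c * ε) := by
  have htop : Tendsto (fun ε : ℝ => ‖Real.log (c * ε)‖) (𝓝[>] 0) atTop :=
    tendsto_abs_atBot_atTop.comp
      (Real.tendsto_log_nhdsGT_zero.comp (tendsto_const_mul_nhdsGT_zero hc))
  have hconst : (fun _ : ℝ => -Real.log c) =o[𝓝[>] 0] fun ε => Real.log (c * ε) :=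
    Asymptotics.isLittleO_const_left.2 (Or.inr htop)
  refine hconst.congr' ?_ EventuallyEq.rfl
  filter_upwards [self_mem_nhdsWithin] with ε hε
  rw [Pi.sub_apply, Real.log_mul hc.ne' (ne_of_gt hε)]
  ring

theorem eventually_log_one_div_pos : ∀ᶠ ε : ℝ in 𝓝[>] 0, 0 < Real.log (1 / ε) := by
  filter_upwards [Ioo_mem_nhdsGT zero_lt_one] with ε ⟨hε, hε1⟩
  exact Real.log_pos ((one_lt_div hε).2 hε1)

theorem limsup_comp_const_mul_div_log_le (h : ℝ → EReal) {c : ℝ} (hc : 0 < c) :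
    limsup (fun ε : ℝ => h (c * ε) / (Real.log (1 / ε) : EReal)) (𝓝[>] 0) ≤
      limsup (fun ε : ℝ => h ε / ((-Real.log ε : ℝ) : EReal)) (𝓝[>] 0) := by
  have hequiv : Asymptotics.IsEquivalent (𝓝[>] 0) (fun ε : ℝ => Real.log (1 / ε))
      fun ε => -Real.log (c * ε) := by
    simpa only [one_div, Real.log_inv] using (isEquivalent_log_log_const_mul hc).neg
  calc _ ≤ limsup (fun ε : ℝ => h (c * ε) / ((-Real.log (c * ε) : ℝ) : EReal)) (𝓝[>] 0) :=
        limsup_div_le_of_isEquivalent hequiv eventually_log_one_div_pos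
    _ = limsup (fun ε : ℝ => h ε / ((-Real.log ε : ℝ) : EReal)) (Filter.map (c * ·) (𝓝[>] 0)) := rfl
    _ ≤ _ := limsup_le_limsup_of_le (tendsto_const_mul_nhdsGT_zero hc)

theorem expGrowthSup_le_of_limsup_exp_mul_eq_zero {u : ℕ → ENNReal} {r : ℝ}
    (h : limsup (fun n : ℕ => ENNReal.ofReal (Real.exp (-r * (n + 1))) * u n) atTop = 0) :
    ExpGrowth.expGrowthSup u ≤ r := by
  rw [← ExpGrowth.expGrowthSup_exp (a := r)]
  refine ExpGrowth.expGrowthSup_le_of_eventually_le (b := ENNReal.ofReal (Real.exp r))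
    ENNReal.ofReal_ne_top ?_
  filter_upwards [eventually_lt_of_limsup_lt (h.trans_lt zero_lt_one)] with n hn
  have hu : u n ≤ (ENNReal.ofReal (Real.exp (-r * (n + 1))))⁻¹ := by
    rw [ENNReal.le_inv_iff_mul_le, mul_comm]
    exact hn.le
  refine hu.trans_eq ?_
  rw [← ENNReal.ofReal_inv_of_pos (Real.exp_pos _), ← Real.exp_neg, ← EReal.coe_natCast,
    ← EReal.coe_mul, EReal.exp_coe, ← ENNReal.ofReal_mul (Real.exp_pos _).le, ← Real.exp_add]
  congr 2
  ring

theorem limsup_exp_mul_eq_zero_of_expGrowthSup_lt {u : ℕ → ENNReal} {r : ℝ}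
    (h : ExpGrowth.expGrowthSup u < r) :
    limsup (fun n : ℕ => ENNReal.ofReal (Real.exp (-r * (n + 1))) * u n) atTop = 0 := by
  obtain ⟨s, hus, hsr⟩ := EReal.exists_between_coe_real h
  have hgeom : Tendsto (fun n : ℕ => ENNReal.ofReal (Real.exp (-r) * Real.exp (s - r) ^ n)) atTop
      (𝓝 0) := by
    have := (tendsto_pow_atTop_nhds_zero_of_lt_one (Real.exp_pos (s - r)).le
      (Real.exp_lt_one_iff.2 (sub_neg.2 (EReal.coe_lt_coe_iff.1 hsr)))).const_mul (Real.exp (-r))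
    simpa only [mul_zero, ENNReal.ofReal_zero] using ENNReal.tendsto_ofReal this
  refine Tendsto.limsup_eq (tendsto_of_tendsto_of_tendsto_of_le_of_le' tendsto_const_nhds hgeom
    (Eventually.of_forall fun _ => zero_le) ?_)
  filter_upwards [ExpGrowth.eventually_le_exp hus] with n hn
  calc _ ≤ ENNReal.ofReal (Real.exp (-r * (n + 1))) * EReal.exp (s * n) := by gcongr
    _ = ENNReal.ofReal (Real.exp (-r) * Real.exp (s - r) ^ n) := by
        rw [← EReal.coe_natCast, ← EReal.coe_mul, EReal.exp_coe,
          ← ENNReal.ofReal_mul (Real.exp_pos _).le, ← Real.exp_add, ← Real.exp_nat_mul,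
          ← Real.exp_add]
        congr 2
        ring

theorem sInf_limsup_exp_mul_eq_zero_eq_expGrowthSup (u : ℕ → ENNReal) :
    sInf ((fun r : ℝ => (r : EReal)) '' {r : ℝ | limsup (fun n : ℕ =>
      ENNReal.ofReal (Real.exp (-r * (n + 1))) * u n) atTop = 0}) =
      ExpGrowth.expGrowthSup u := by
  refine le_antisymm (EReal.le_of_forall_lt_iff_le.1 fun r hr => ?_) (le_sInf ?_)
  · exact sInf_le ⟨r, limsup_exp_mul_eq_zero_of_expGrowthSup_lt hr, rfl⟩
  · rintro _ ⟨r, hr, rfl⟩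
    exact expGrowthSup_le_of_limsup_exp_mul_eq_zero hr

end GrowthRates

variable {X Y : Type*}


section Words

theorem wordMap_append (f : Y → X → X) (u v : List Y) (x : X) :
    wordMap f (u ++ v) x = wordMap f u (wordMap f v x) := by
  induction u with
  | nil => rfl
  | cons y u ih => simp only [List.cons_append, wordMap, Function.comp_apply, ih]

theorem continuous_wordMap [TopologicalSpace X] {f : Y → X → X} (hf : ∀ y, Continuous (f y))
    (w : List Y) : Continuous (wordMap f w) := by
  induction w with
  | nil => exact continuous_id
  | cons y w ih => exact (hf y).comp ih

@[simp]
theorem length_firstWord (ω : ℕ → Y) (n : ℕ) : (firstWord ω n).length = n := by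
  simp only [firstWord, List.length_map, List.length_range]

theorem take_firstWord (ω : ℕ → Y) {k n : ℕ} (h : k ≤ n) :
    (firstWord ω n).take k = firstWord ω k := by
  simp only [firstWord, ← List.map_take, List.take_range, min_eq_left h]

theorem exists_firstWord_eq (W : ℕ → List Y) (hW : ∀ j, W j <+: W (j + 1))
    (hlen : ∀ j, j < (W j).length) :
    ∃ ω : ℕ → Y, ∀ j, firstWord ω (W j).length = W j := by
  have hmono : ∀ i j, i ≤ j → W i <+: W j := fun i j h =>
    Nat.le_induction (List.prefix_refl _) (fun n _ ih => ih.trans (hW n)) j h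
  refine ⟨fun i => (W i)[i]'(hlen i), fun j => ?_⟩
  refine List.ext_getElem (length_firstWord _ _) fun k h₁ h₂ => ?_
  simp only [firstWord, List.getElem_map, List.getElem_range]
  rcases le_total k j with h | h
  · exact (hmono k j h).getElem _
  · exact ((hmono j k h).getElem _).symm

/-- The `n`-th point `f_{i_n ⋯ i_1}(x)` of the orbit of `x` driven by `ω = (i₁ i₂ ⋯)`. -/
def orbit (f : Y → X → X) (ω : ℕ → Y) (x : X) (n : ℕ) : X :=
  wordMap f (firstWord ω n).reverse x

/-- The orbit segment `(x, f_{i₁} x, …, f_{i_N ⋯ i₁} x)` along `w = i₁ ⋯ i_N`, as a point of the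
product space `X^(N + 1)`: it turns `d_w` into the sup distance and `X_w(𝐔)` into the preimage of a
box. -/
def orbitSegment (f : Y → X → X) (w : List Y) (x : X) : Fin (w.length + 1) → X :=
  fun j => wordMap f (w.take j).reverse x

theorem continuous_orbitSegment [TopologicalSpace X] {f : Y → X → X}
    (hf : ∀ y, Continuous (f y)) (w : List Y) : Continuous (orbitSegment f w) :=
  continuous_pi fun _ => continuous_wordMap hf _

end Words

section WordDist

variable [MetricSpace X]

theorem wordDist_eq_dist_orbitSegment (f : Y → X → X) (w : List Y) (x₁ x₂ : X) :
    wordDist f w x₁ x₂ = dist (orbitSegment f w x₁) (orbitSegment f w x₂) := by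
  have : Nonempty {w' : List Y // w' <:+ w.reverse} := ⟨⟨[], List.nil_suffix⟩⟩
  have hle : ∀ w' : {w' : List Y // w' <:+ w.reverse},
      dist (wordMap f w' x₁) (wordMap f w' x₂) ≤
        dist (orbitSegment f w x₁) (orbitSegment f w x₂) := by
    rintro ⟨w', hw'⟩
    have hp : w'.reverse <+: w := by rwa [← List.reverse_suffix, List.reverse_reverse]
    have h := dist_le_pi_dist (orbitSegment f w x₁) (orbitSegment f w x₂)
      ⟨w'.reverse.length, Nat.lt_succ_of_le hp.length_le⟩
    rwa [orbitSegment, orbitSegment, ← List.prefix_iff_eq_take.1 hp, List.reverse_reverse] at h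
  refine le_antisymm (ciSup_le hle) ?_
  refine (dist_pi_le_iff (Real.iSup_nonneg fun _ => dist_nonneg)).2 fun j => ?_
  exact le_ciSup (f := fun w' : {w' : List Y // w' <:+ w.reverse} =>
    dist (wordMap f w' x₁) (wordMap f w' x₂)) ⟨_, Set.forall_mem_range.2 hle⟩
    ⟨(w.take j).reverse, List.reverse_suffix.2 (List.take_prefix j w)⟩

theorem dist_orbit_le_wordDist (f : Y → X → X) (ω : ℕ → Y) {i n : ℕ} (hi : i ≤ n) (x₁ x₂ : X) :
    dist (orbit f ω x₁ i) (orbit f ω x₂ i) ≤ wordDist f (firstWord ω n) x₁ x₂ := by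
  have h := dist_le_pi_dist (orbitSegment f (firstWord ω n) x₁) (orbitSegment f (firstWord ω n) x₂)
    ⟨i, by rw [length_firstWord]; exact Nat.lt_succ_of_le hi⟩
  simp only [orbitSegment, take_firstWord ω hi] at h
  rwa [wordDist_eq_dist_orbitSegment]

end WordDist

section Counting

theorem exists_isSeparated_isCover_univ (R : SetRel X X) [R.IsRefl] [R.IsSymm] :
    ∃ N : Set X, R.IsSeparated N ∧ R.IsCover Set.univ N := by
  obtain ⟨N, hN⟩ := zorn_subset {N : Set X | N ⊆ Set.univ ∧ R.IsSeparated N} fun c hc hchain =>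
    ⟨⋃₀ c, ⟨Set.subset_univ _, (Set.pairwise_sUnion hchain.directedOn).2 fun s hs => (hc hs).2⟩,
      fun s hs => Set.subset_sUnion_of_mem hs⟩
  exact ⟨N, hN.prop.2, .of_maximal_isSeparated hN⟩

variable [MetricSpace X]

theorem exists_wordDist_separated_cover (f : Y → X → X) (w : List Y) {δ : ℝ} (hδ : 0 ≤ δ) :
    ∃ K : Set X, (K.Pairwise fun x₁ x₂ => δ < wordDist f w x₁ x₂) ∧
      ∀ x, ∃ y ∈ K, wordDist f w x y ≤ δ := by
  let R : SetRel X X := {p | wordDist f w p.1 p.2 ≤ δ}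
  have : R.IsRefl := ⟨fun x => by
    change wordDist f w x x ≤ δ
    rwa [wordDist_eq_dist_orbitSegment, dist_self]⟩
  have : R.IsSymm := ⟨fun x y h => by
    change wordDist f w y x ≤ δ
    rw [wordDist_eq_dist_orbitSegment, dist_comm, ← wordDist_eq_dist_orbitSegment]
    exact h⟩
  obtain ⟨K, hsep, hcover⟩ := exists_isSeparated_isCover_univ R
  exact ⟨K, fun x hx y hy hxy => not_le.1 (hsep hx hy hxy), fun x => hcover (Set.mem_univ x)⟩

theorem wordDist_le_of_mem_closure_stringSet {f : Y → X → X} (hf : ∀ y, Continuous (f y))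
    {w : List Y} {U : Fin (w.length + 1) → Set X} {ε : ℝ} (hε : 0 ≤ ε)
    (hU : ∀ j, Metric.ediam (U j) ≤ ENNReal.ofReal ε) {x₁ x₂ : X}
    (h₁ : x₁ ∈ closure (stringSet f w U)) (h₂ : x₂ ∈ closure (stringSet f w U)) :
    wordDist f w x₁ x₂ ≤ ε := by
  have hmem : ∀ x ∈ closure (stringSet f w U), ∀ j, orbitSegment f w x j ∈ closure (U j) :=
    fun x hx j =>
      map_mem_closure (f := fun z => orbitSegment f w z j) (continuous_wordMap hf _) hx
        fun _ hz => hz j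
  rw [wordDist_eq_dist_orbitSegment, dist_pi_le_iff hε]
  intro j
  rw [← edist_le_ofReal hε]
  calc _ ≤ Metric.ediam (closure (U j)) :=
        Metric.edist_le_ediam_of_mem (hmem x₁ h₁ j) (hmem x₂ h₂ j)
    _ ≤ ENNReal.ofReal ε := (Metric.ediam_closure _).trans_le (hU j)

/- A finite union commutes with closure, so the closures of the sets `X_w(𝐔)` cover all of `X`, and
each of them contains at most one point of a separated set. -/
theorem sepCard_univ_le_coverCard_of_dense {f : Y → X → X} (hf : ∀ y, Continuous (f y)) {Z : Set X}
    (hZ : Dense Z) (w : List Y) {ε : ℝ} (hε : 0 ≤ ε) :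
    sepCard f w ε Set.univ ≤ coverCard f w ε Z := by
  refine iSup₂_le fun K _ => iSup_le fun hK => ?_
  refine le_iInf₂ fun 𝒰 h𝒰 => le_iInf₂ fun 𝒢 _ => le_iInf₂ fun h𝒢 hcov => ?_
  rcases 𝒢.finite_or_infinite with hfin | hinf
  swap
  · exact hinf.encard_eq ▸ le_top
  have hclosure : ∀ x, ∃ U ∈ 𝒢, x ∈ closure (stringSet f w U) := fun x => by
    have hx : x ∈ closure (⋃ U ∈ 𝒢, stringSet f w U) := closure_mono hcov (hZ x)
    simpa only [hfin.closure_biUnion, Set.mem_iUnion₂, exists_prop] using hx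
  choose g hg hxg using hclosure
  have hdiam : ∀ x j, Metric.ediam (g x j) ≤ ENNReal.ofReal ε := fun x j =>
    (le_iSup₂ (f := fun U (_ : U ∈ 𝒰) => Metric.ediam U) _ (h𝒢 _ (hg x) j)).trans h𝒰.2.2.le
  refine Set.encard_le_encard_of_injOn (fun x _ => hg x) fun x hx y hy hxy => ?_
  by_contra hne
  exact (hK hx hy hne).not_ge
    (wordDist_le_of_mem_closure_stringSet hf hε (hdiam x) (hxg x) (hxy ▸ hxg y))

theorem coverCard_mono (f : Y → X → X) (w : List Y) (ε : ℝ) {Z Z' : Set X} (h : Z ⊆ Z') :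
    coverCard f w ε Z ≤ coverCard f w ε Z' := by
  refine le_iInf₂ fun 𝒰 h𝒰 => le_iInf₂ fun 𝒢 hc => le_iInf₂ fun h𝒢 hcov => ?_
  exact iInf₂_le_of_le 𝒰 h𝒰 <| iInf₂_le_of_le 𝒢 hc <| iInf₂_le_of_le h𝒢 (h.trans hcov) le_rfl

theorem range_ball_mem_openCovers {r ε : ℝ} (hr : 0 < r) (hrε : 2 * r < ε) :
    (Set.range fun x : X => Metric.ball x r) ∈ openCovers X ε := by
  refine ⟨Set.forall_mem_range.2 fun _ => Metric.isOpen_ball,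
    Set.eq_univ_of_forall fun x => ⟨_, ⟨x, rfl⟩, Metric.mem_ball_self hr⟩, ?_⟩
  refine lt_of_le_of_lt (iSup₂_le (Set.forall_mem_range.2 fun x => ?_))
    ((ENNReal.ofReal_lt_ofReal_iff (by linarith)).2 hrε)
  rw [← Metric.eball_ofReal, ENNReal.ofReal_mul zero_le_two, ENNReal.ofReal_ofNat]
  exact Metric.ediam_eball_le

theorem coverCard_univ_le_sepCard (f : Y → X → X) (w : List Y) {δ ε : ℝ} (hδ : 0 ≤ δ)
    (hδε : 2 * δ < ε) :
    coverCard f w ε Set.univ ≤ sepCard f w δ Set.univ := by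
  obtain ⟨K, hsep, hcover⟩ := exists_wordDist_separated_cover f w hδ
  have hK : K.encard ≤ sepCard f w δ Set.univ :=
    le_iSup₂_of_le K (Set.subset_univ K) (le_iSup_of_le hsep le_rfl)
  refine le_trans ?_ hK
  rcases K.finite_or_infinite with hfin | hinf
  swap
  · exact hinf.encard_eq ▸ le_top
  obtain ⟨r, hδr, hrε⟩ := exists_between (show δ < ε / 2 by linarith)
  let U : X → Fin (w.length + 1) → Set X := fun x j => Metric.ball (orbitSegment f w x j) r
  have hmem : ∀ V ∈ U '' K, ∀ j, V j ∈ Set.range fun x : X => Metric.ball x r := by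
    rintro _ ⟨x, _, rfl⟩ j
    exact ⟨_, rfl⟩
  have hunion : Set.univ ⊆ ⋃ V ∈ U '' K, stringSet f w V := fun x _ => by
    obtain ⟨y, hy, hxy⟩ := hcover x
    refine Set.mem_biUnion (Set.mem_image_of_mem U hy) fun j => ?_
    rw [wordDist_eq_dist_orbitSegment] at hxy
    exact ((dist_le_pi_dist _ _ j).trans hxy).trans_lt hδr
  calc coverCard f w ε Set.univ ≤ (U '' K).encard :=
        iInf₂_le_of_le _ (range_ball_mem_openCovers (hδ.trans_lt hδr) (by linarith)) <|
          iInf₂_le_of_le _ (hfin.image U).countable <| iInf₂_le_of_le hmem hunion le_rfl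
    _ ≤ K.encard := Set.encard_image_le U K

end Counting

section MeanDimension

variable [MetricSpace X] [MeasurableSpace Y]

theorem entropyAt_eq_expGrowthSup (f : Y → X → X) (ℙ : Measure (ℕ → Y)) (ε : ℝ) :
    entropyAt f ℙ ε = ExpGrowth.expGrowthSup fun n =>
      ∫⁻ ω, (sepCard f (firstWord ω n) ε Set.univ : ENNReal) ∂ℙ :=
  rfl

theorem upperUmdimAt_eq_expGrowthSup (f : Y → X → X) (ℙ : Measure (ℕ → Y)) (Z : Set X) (ε : ℝ) :
    upperUmdimAt f ℙ Z ε = ExpGrowth.expGrowthSup fun n =>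
      ∫⁻ ω, (coverCard f (firstWord ω n) ε Z : ENNReal) ∂ℙ := by
  rw [← sInf_limsup_exp_mul_eq_zero_eq_expGrowthSup]
  simp only [upperUmdimAt, coverSum, lintegral_const_mul' _ _ ENNReal.ofReal_ne_top]

theorem entropyAt_le_upperUmdimAt_of_dense {f : Y → X → X} (hf : ∀ y, Continuous (f y)) {Z : Set X}
    (hZ : Dense Z) (ℙ : Measure (ℕ → Y)) {ε : ℝ} (hε : 0 ≤ ε) :
    entropyAt f ℙ ε ≤ upperUmdimAt f ℙ Z ε := by
  rw [entropyAt_eq_expGrowthSup, upperUmdimAt_eq_expGrowthSup]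
  refine ExpGrowth.expGrowthSup_monotone fun n => lintegral_mono fun ω => ?_
  exact ENat.toENNReal_mono (sepCard_univ_le_coverCard_of_dense hf hZ _ hε)

theorem upperUmdimAt_le_entropyAt (f : Y → X → X) (ℙ : Measure (ℕ → Y)) (Z : Set X) {δ ε : ℝ}
    (hδ : 0 ≤ δ) (hδε : 2 * δ < ε) : upperUmdimAt f ℙ Z ε ≤ entropyAt f ℙ δ := by
  rw [entropyAt_eq_expGrowthSup, upperUmdimAt_eq_expGrowthSup]
  refine ExpGrowth.expGrowthSup_monotone fun n => lintegral_mono fun ω => ENat.toENNReal_mono ?_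
  exact (coverCard_mono f _ ε (Set.subset_univ Z)).trans (coverCard_univ_le_sepCard f _ hδ hδε)

theorem upperUmdim_le_upperMdimM (f : Y → X → X) (ℙ : Measure (ℕ → Y)) (Z : Set X) :
    upperUmdim f ℙ Z ≤ upperMdimM f ℙ := by
  refine le_trans (limsup_le_limsup ?_)
    (limsup_comp_const_mul_div_log_le (entropyAt f ℙ) (c := 3⁻¹) (by norm_num))
  filter_upwards [self_mem_nhdsWithin, eventually_log_one_div_pos] with ε (hε : 0 < ε) hlog
  exact EReal.div_le_div_right_of_nonneg (EReal.coe_nonneg.2 hlog.le)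
    (upperUmdimAt_le_entropyAt f ℙ Z (by positivity) (by linarith))

theorem upperMdimM_le_upperUmdim_of_dense {f : Y → X → X} (hf : ∀ y, Continuous (f y)) {Z : Set X}
    (hZ : Dense Z) (ℙ : Measure (ℕ → Y)) : upperMdimM f ℙ ≤ upperUmdim f ℙ Z := by
  refine limsup_le_limsup ?_
  filter_upwards [self_mem_nhdsWithin, eventually_log_one_div_pos] with ε (hε : 0 < ε) hlog
  rw [← Real.log_inv, ← one_div]
  exact EReal.div_le_div_right_of_nonneg (EReal.coe_nonneg.2 hlog.le)
    (entropyAt_le_upperUmdimAt_of_dense hf hZ ℙ hε.le)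

theorem upperUmdim_eq_upperMdimM_of_dense {f : Y → X → X} (hf : ∀ y, Continuous (f y)) {Z : Set X}
    (hZ : Dense Z) (ℙ : Measure (ℕ → Y)) : upperUmdim f ℙ Z = upperMdimM f ℙ :=
  le_antisymm (upperUmdim_le_upperMdimM f ℙ Z) (upperMdimM_le_upperUmdim_of_dense hf hZ ℙ)

end MeanDimension

section Gluing

variable [MetricSpace X]

theorem glueWord_congr (w : ℕ → List Y) {v v' : ℕ → List Y} {j : ℕ} (h : ∀ i < j, v i = v' i) :
    glueWord w v j = glueWord w v' j := by
  induction j with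
  | zero => rfl
  | succ j ih =>
    simp only [glueWord]
    rw [h j j.lt_succ_self, ih fun i hi => h i (hi.trans j.lt_succ_self)]

theorem exists_glue_finite {f : Y → X → X} (hglue : GluingOrbitProperty f) {ε : ℝ} (hε : 0 < ε) :
    ∃ P : ℕ, ∀ (y : Y) (x : ℕ → X) (w : ℕ → List Y), (∀ j, 0 < (w j).length) → ∀ k : ℕ,
      ∃ (p : ℕ → Fin (P + 1)) (z : X), ∀ j < k, wordDist f (w j) (x j)
        (wordMap f (glueWord w (fun l => List.replicate (p l) y) j) z) ≤ ε := by
  obtain ⟨P, -, hP⟩ := hglue ε hε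
  refine ⟨P, fun y x w hw k => ?_⟩
  obtain ⟨q, hq, hv⟩ := hP (k + 2) (Nat.le_add_left 2 k) x w fun j _ => hw j
  obtain ⟨z, hz₀, hz⟩ := hv (fun l => List.replicate (q l) y) fun _ _ => List.length_replicate
  refine ⟨fun l => Fin.ofNat (P + 1) (q l), z, fun j hj => ?_⟩
  rw [glueWord_congr w (v' := fun l => List.replicate (q l) y) fun l hl => by
    rw [Fin.val_ofNat, Nat.mod_eq_of_lt (Nat.lt_succ_of_le (hq l (by lia)))]]
  rcases j.eq_zero_or_pos with rfl | hpos
  · exact le_of_lt hz₀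
  · exact le_of_lt (Set.mem_iInter₂.1 hz j (Finset.mem_Ico.2 ⟨hpos, by lia⟩))

theorem exists_glue_infinite [CompactSpace X] {f : Y → X → X} (hglue : GluingOrbitProperty f)
    (hf : ∀ y, Continuous (f y)) {ε : ℝ} (hε : 0 < ε) :
    ∃ P : ℕ, ∀ (y : Y) (x : ℕ → X) (w : ℕ → List Y), (∀ j, 0 < (w j).length) →
      ∃ (p : ℕ → Fin (P + 1)) (z : X), ∀ j, wordDist f (w j) (x j)
        (wordMap f (glueWord w (fun l => List.replicate (p l) y) j) z) ≤ ε := by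
  obtain ⟨P, hP⟩ := exists_glue_finite hglue hε
  refine ⟨P, fun y x w hw => ?_⟩
  choose q z hqz using hP y x w hw
  obtain ⟨⟨p, z'⟩, s, hs, hlim⟩ := CompactSpace.tendsto_subseq fun k => (q k, z k)
  obtain ⟨hp, hz⟩ := Prod.tendsto_iff _ _ |>.1 hlim
  refine ⟨p, z', fun j => ?_⟩
  have hword : ∀ᶠ k in atTop, glueWord w (fun l => List.replicate (q (s k) l) y) j =
      glueWord w (fun l => List.replicate (p l) y) j := by
    have hcoord : ∀ᶠ k in atTop, ∀ l ∈ Set.Iio j, q (s k) l = p l :=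
      (eventually_all_finite (Set.finite_Iio j)).2 fun l _ =>
        tendsto_pure.1 (nhds_discrete (Fin (P + 1)) ▸ tendsto_pi_nhds.1 hp l)
    filter_upwards [hcoord] with k hk
    exact glueWord_congr w fun l hl => by rw [hk l hl]
  have hcont : Continuous fun t => wordDist f (w j) (x j)
      (wordMap f (glueWord w (fun l => List.replicate (p l) y) j) t) := by
    simp only [wordDist_eq_dist_orbitSegment]
    exact continuous_const.dist ((continuous_orbitSegment hf _).comp (continuous_wordMap hf _))
  refine le_of_tendsto ((hcont.tendsto z').comp hz) ?_
  filter_upwards [hword, eventually_gt_atTop j] with k hk hjk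
  have h := hqz (s k) j (hjk.trans_le hs.le_apply)
  rwa [hk] at h

theorem exists_firstWord_glueWord_eq (w v : ℕ → List Y) (hw : ∀ j, 0 < (w j).length) :
    ∃ ω : ℕ → Y, ∀ j, firstWord ω ((glueWord w v j).length + (w j).length) =
      (glueWord w v j).reverse ++ w j := by
  let W : ℕ → List Y := fun j => (glueWord w v j).reverse ++ w j
  have hsucc : ∀ j, W (j + 1) = W j ++ (v j ++ w (j + 1)) := fun j => by
    simp only [W, glueWord, List.reverse_append, List.reverse_reverse, List.append_assoc]
  have hlen : ∀ j, j < (W j).length := fun j => by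
    induction j with
    | zero => exact (hw 0).trans_le (List.suffix_append _ _).length_le
    | succ j ih =>
      have := hw (j + 1)
      rw [hsucc, List.length_append, List.length_append (as := v j)]
      lia
  obtain ⟨ω, hω⟩ := exists_firstWord_eq W (fun j => hsucc j ▸ List.prefix_append _ _) hlen
  exact ⟨ω, fun j => by simpa only [W, List.length_append, List.length_reverse] using hω j⟩

theorem exists_orbit_shadowing [CompactSpace X] {f : Y → X → X} (hglue : GluingOrbitProperty f)
    (hf : ∀ y, Continuous (f y)) {ε : ℝ} (hε : 0 < ε) :
    ∃ P : ℕ, ∀ (x : ℕ → X) (ω' : ℕ → ℕ → Y) (n : ℕ → ℕ), (∀ j, 0 < n j) →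
      ∃ (z : X) (ω : ℕ → Y) (M : ℕ → ℕ), M 0 = 0 ∧ (∀ j, M (j + 1) ≤ M j + n j + P) ∧
        ∀ j, ∀ i ≤ n j, dist (orbit f ω z (M j + i)) (orbit f (ω' j) (x j) i) ≤ ε := by
  obtain ⟨P, hP⟩ := exists_glue_infinite hglue hf hε
  refine ⟨P, fun x ω' n hn => ?_⟩
  let w : ℕ → List Y := fun j => firstWord (ω' j) (n j)
  have hwlen : ∀ j, (w j).length = n j := fun j => length_firstWord _ _
  have hw : ∀ j, 0 < (w j).length := fun j => (hn j).trans_eq (hwlen j).symm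
  obtain ⟨p, z, hz⟩ := hP (ω' 0 0) x w hw
  let v : ℕ → List Y := fun l => List.replicate (p l) (ω' 0 0)
  obtain ⟨ω, hω⟩ := exists_firstWord_glueWord_eq w v hw
  refine ⟨z, ω, fun j => (glueWord w v j).length, rfl, fun j => ?_, fun j i hi => ?_⟩
  · have := (p j).is_le
    simp only [glueWord, List.length_append, List.length_reverse, hwlen, v, List.length_replicate]
    lia
  · have hprefix : firstWord ω ((glueWord w v j).length + i) =
        (glueWord w v j).reverse ++ firstWord (ω' j) i := by
      rw [← take_firstWord ω (Nat.add_le_add_left (hi.trans_eq (hwlen j).symm) _), hω,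
        ← List.length_reverse, List.take_length_add_append, take_firstWord _ hi]
    have horbit : orbit f ω z ((glueWord w v j).length + i) =
        orbit f (ω' j) (wordMap f (glueWord w v j) z) i := by
      rw [orbit, hprefix, List.reverse_append, List.reverse_reverse, wordMap_append, orbit]
    rw [horbit, dist_comm]
    exact (dist_orbit_le_wordDist f (ω' j) hi _ _).trans (hz j)

end Gluing

section CesaroMeans

variable {E : Type*} [SeminormedAddCommGroup E] [NormedSpace ℝ E]

/-- The Cesàro mean `(u 0 + ⋯ + u (n - 1)) / n` of a sequence of vectors, with value `0` at `n = 0`;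
applied to `u j = φ (orbit f ω x j)` it is the Birkhoff average in the definition of `I_φ(G)`. -/
noncomputable def cesaroMean (u : ℕ → E) (n : ℕ) : E :=
  (1 / (n : ℝ)) • ∑ i ∈ Finset.range n, u i

theorem norm_cesaroMean_le {u : ℕ → E} {C : ℝ} (hC : 0 ≤ C) {n : ℕ} (hu : ∀ i < n, ‖u i‖ ≤ C) :
    ‖cesaroMean u n‖ ≤ C := by
  have hsum : ‖∑ i ∈ Finset.range n, u i‖ ≤ n * C := by
    simpa only [Finset.sum_const, Finset.card_range, nsmul_eq_mul] using
      norm_sum_le_of_le (Finset.range n) fun i hi => hu i (Finset.mem_range.1 hi)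
  rw [cesaroMean, norm_smul, Real.norm_of_nonneg (by positivity), one_div]
  exact inv_mul_le_of_le_mul₀ n.cast_nonneg hC hsum

theorem dist_cesaroMean_le {u u' : ℕ → E} {η : ℝ} (hη : 0 ≤ η) {n : ℕ}
    (h : ∀ i < n, dist (u i) (u' i) ≤ η) : dist (cesaroMean u n) (cesaroMean u' n) ≤ η := by
  have hsub : cesaroMean u n - cesaroMean u' n = cesaroMean (fun i => u i - u' i) n := by
    simp only [cesaroMean, Finset.sum_sub_distrib, smul_sub]
  rw [dist_eq_norm, hsub]
  exact norm_cesaroMean_le hη fun i hi => (dist_eq_norm _ _).symm.trans_le (h i hi)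

theorem cesaroMean_add_sub_cesaroMean_shift (u : ℕ → E) (M : ℕ) {n : ℕ} (hn : 0 < n) :
    cesaroMean u (M + n) - cesaroMean (fun i => u (M + i)) n =
      ((M : ℝ) / (M + n)) • (cesaroMean u M - cesaroMean (fun i => u (M + i)) n) := by
  have : (0 : ℝ) < n := Nat.cast_pos.2 hn
  rcases M.eq_zero_or_pos with rfl | hM
  · simp only [zero_add, sub_self, Nat.cast_zero, zero_div, zero_smul]
  have : (0 : ℝ) < M := Nat.cast_pos.2 hM
  simp only [cesaroMean, Finset.sum_range_add, Nat.cast_add]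
  match_scalars <;> field_simp
  ring

theorem dist_cesaroMean_add_shift_le {u : ℕ → E} {C : ℝ} (hu : ∀ i, ‖u i‖ ≤ C) (M : ℕ) {n : ℕ}
    (hn : 0 < n) :
    dist (cesaroMean u (M + n)) (cesaroMean (fun i => u (M + i)) n) ≤ 2 * C * (M / n) := by
  have hC : 0 ≤ C := (norm_nonneg _).trans (hu 0)
  have : (0 : ℝ) < n := Nat.cast_pos.2 hn
  rw [dist_eq_norm, cesaroMean_add_sub_cesaroMean_shift u M hn, norm_smul,
    Real.norm_of_nonneg (by positivity), mul_comm]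
  have hdiff : ‖cesaroMean u M - cesaroMean (fun i => u (M + i)) n‖ ≤ 2 * C :=
    (norm_sub_le_of_le (norm_cesaroMean_le hC fun i _ => hu i)
      (norm_cesaroMean_le hC fun i _ => hu (M + i))).trans_eq (two_mul C).symm
  gcongr
  exact le_add_of_nonneg_left M.cast_nonneg

theorem dist_cesaroMean_add_le {u u' : ℕ → E} {C η : ℝ} {M n : ℕ} (hn : 0 < n)
    (hu : ∀ i, ‖u i‖ ≤ C) (h : ∀ i < n, dist (u (M + i)) (u' i) ≤ η) :
    dist (cesaroMean u (M + n)) (cesaroMean u' n) ≤ 2 * C * (M / n) + η :=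
  (dist_triangle _ _ _).trans <| add_le_add (dist_cesaroMean_add_shift_le hu M hn)
    (dist_cesaroMean_le (dist_nonneg.trans (h 0 hn)) h)

end CesaroMeans

section Oscillation

variable {α : Type*} [PseudoMetricSpace α]

theorem exists_dist_ge_of_not_cauchySeq {a : ℕ → α} (ha : ¬ CauchySeq a) :
    ∃ δ > 0, ∀ (N : ℕ) (c : α), ∃ n ≥ N, δ ≤ dist (a n) c := by
  rw [Metric.cauchySeq_iff] at ha
  push Not at ha
  obtain ⟨δ, hδ, h⟩ := ha
  refine ⟨δ / 2, half_pos hδ, fun N c => ?_⟩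
  obtain ⟨m, hm, n, hn, hmn⟩ := h N
  by_contra! hnear
  linarith [dist_triangle_right (a m) (a n) c, hnear m hm, hnear n hn]

theorem exists_oscillating_times {a : ℕ → α} {δ : ℝ}
    (ha : ∀ (N : ℕ) (c : α), ∃ n ≥ N, δ ≤ dist (a n) c) (P : ℕ) :
    ∃ n : ℕ → ℕ, (∀ j, j < n j) ∧ (∀ j, j * ∑ i ∈ Finset.range j, (n i + P) ≤ n j) ∧
      ∀ j, δ ≤ dist (a (n (j + 1))) (a (n j)) := by
  choose g hg hdist using ha
  let s : ℕ → ℕ × ℕ := fun j => Nat.rec (1, 0) (fun j t =>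
    (g ((j + 1) * (t.2 + (t.1 + P)) + j + 2) (a t.1), t.2 + (t.1 + P))) j
  have hsum : ∀ j, ∑ i ∈ Finset.range j, ((s i).1 + P) = (s j).2 := fun j => by
    induction j with
    | zero => rfl
    | succ j ih => rw [Finset.sum_range_succ, ih]
  have hgrow : ∀ j, j * (s j).2 + j < (s j).1 := fun j => by
    cases j with
    | zero => exact Nat.one_pos
    | succ j => exact (Nat.lt_succ_self _).trans_le (hg _ _)
  refine ⟨fun j => (s j).1, fun j => ?_, fun j => ?_, fun j => hdist _ _⟩
  · exact (Nat.le_add_left _ _).trans_lt (hgrow j)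
  · rw [hsum]
    exact (Nat.le_add_right _ _).trans (hgrow j).le

theorem tendsto_div_zero_of_mul_le {M n : ℕ → ℕ} (h : ∀ j, j * M j ≤ n j) :
    Tendsto (fun j => (M j : ℝ) / n j) atTop (𝓝 0) := by
  refine squeeze_zero' (Eventually.of_forall fun j => by positivity) ?_
    tendsto_one_div_atTop_nhds_zero_nat
  filter_upwards [eventually_gt_atTop 0] with j hj
  refine div_le_of_le_mul₀ (Nat.cast_nonneg _) (by positivity) ?_
  rw [one_div, le_inv_mul_iff₀ (Nat.cast_pos.2 hj)]
  exact_mod_cast h j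

theorem not_cauchySeq_of_dist_comp_le {a b : ℕ → α} {n T : ℕ → ℕ} {δ η : ℝ}
    (hT : Tendsto T atTop atTop) (hδ : ∀ j, δ ≤ dist (a (n (j + 1))) (a (n j)))
    (hη : ∀ᶠ j in atTop, dist (b (T j)) (a (n j)) ≤ η) (hηδ : 2 * η < δ) : ¬ CauchySeq b := by
  intro hb
  obtain ⟨N, hN⟩ := Metric.cauchySeq_iff.1 hb (δ - 2 * η) (sub_pos.2 hηδ)
  have hclose : ∀ᶠ j in atTop, dist (b (T j)) (a (n j)) ≤ η ∧ N ≤ T j :=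
    hη.and (hT.eventually_ge_atTop N)
  obtain ⟨j, ⟨hj, hNj⟩, hj', hNj'⟩ :=
    (hclose.and ((tendsto_add_atTop_nat 1).eventually hclose)).exists
  have htri := dist_triangle4 (a (n (j + 1))) (b (T (j + 1))) (b (T j)) (a (n j))
  rw [dist_comm (a _) (b _)] at htri
  linarith [hN _ hNj' _ hNj, hδ j]

end Oscillation

section IrregularSet

variable {E : Type*} [SeminormedAddCommGroup E] [NormedSpace ℝ E]

theorem mem_irregularSet_iff_exists_not_cauchySeq [CompleteSpace E] {f : Y → X → X} {φ : X → E}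
    {x : X} :
    x ∈ irregularSet f φ ↔ ∃ ω, ¬ CauchySeq (cesaroMean fun j => φ (orbit f ω x j)) :=
  exists_congr fun _ => not_congr
    ⟨fun ⟨_, h⟩ => h.cauchySeq, fun h => cauchySeq_tendsto_of_complete h⟩

variable [MetricSpace X] [CompactSpace X]

theorem exists_dist_le_and_orbit_shadowing {f : Y → X → X} (hglue : GluingOrbitProperty f)
    (hf : ∀ y, Continuous (f y)) {ε : ℝ} (hε : 0 < ε) :
    ∃ P : ℕ, ∀ (t x₀ : X) (ω₀ : ℕ → Y) (n : ℕ → ℕ), (∀ j, 0 < n j) →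
      ∃ (z : X) (ω : ℕ → Y) (M : ℕ → ℕ), dist z t ≤ ε ∧
        (∀ j, M j ≤ ∑ i ∈ Finset.range j, (n i + P)) ∧
        ∀ j > 0, ∀ i ≤ n j, dist (orbit f ω z (M j + i)) (orbit f ω₀ x₀ i) ≤ ε := by
  obtain ⟨P, hP⟩ := exists_orbit_shadowing hglue hf hε
  refine ⟨P, fun t x₀ ω₀ n hn => ?_⟩
  obtain ⟨z, ω, M, hM₀, hM, hshadow⟩ := hP (fun j => if j = 0 then t else x₀) (fun _ => ω₀) n hn
  refine ⟨z, ω, M, ?_, fun j => ?_, fun j hj i hi => ?_⟩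
  · have h := hshadow 0 0 (Nat.zero_le _)
    rwa [hM₀] at h
  · induction j with
    | zero => exact hM₀.le
    | succ j ih =>
      rw [Finset.sum_range_succ, ← add_assoc]
      exact (hM j).trans (by gcongr)
  · have h := hshadow j i hi
    rwa [if_neg hj.ne'] at h

theorem dense_irregularSet [CompleteSpace E] {f : Y → X → X} (hglue : GluingOrbitProperty f)
    (hf : ∀ y, Continuous (f y)) {φ : X → E} (hφ : Continuous φ)
    (hne : (irregularSet f φ).Nonempty) : Dense (irregularSet f φ) := by
  obtain ⟨x₀, hx₀⟩ := hne
  obtain ⟨ω₀, hω₀⟩ := mem_irregularSet_iff_exists_not_cauchySeq.1 hx₀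
  obtain ⟨δ, hδ, hosc⟩ := exists_dist_ge_of_not_cauchySeq hω₀
  obtain ⟨C, hC⟩ := isCompact_univ.exists_bound_of_continuousOn hφ.continuousOn
  obtain ⟨ρ, hρ, hφρ⟩ := Metric.uniformContinuous_iff.1
    (CompactSpace.uniformContinuous_of_continuous hφ) (δ / 8) (by positivity)
  refine Metric.dense_iff.2 fun t r hr => ?_
  obtain ⟨ε, hε, hεr⟩ := exists_between (lt_min hr hρ)
  obtain ⟨P, hP⟩ := exists_dist_le_and_orbit_shadowing hglue hf hε
  obtain ⟨n, hn, hnP, hdist⟩ := exists_oscillating_times hosc P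
  obtain ⟨z, ω, M, hzt, hM, hshadow⟩ := hP t x₀ ω₀ n fun j => j.zero_le.trans_lt (hn j)
  refine ⟨z, hzt.trans_lt (hεr.trans_le (min_le_left _ _)),
    mem_irregularSet_iff_exists_not_cauchySeq.2 ⟨ω, ?_⟩⟩
  have hT : Tendsto (fun j => M j + n j) atTop atTop :=
    tendsto_atTop_mono (fun j => (hn j).le.trans (Nat.le_add_left _ _)) tendsto_id
  have hratio : Tendsto (fun j => 2 * C * ((M j : ℝ) / n j) + δ / 8) atTop (𝓝 (δ / 8)) := by
    have hlim : Tendsto (fun j => (M j : ℝ) / n j) atTop (𝓝 0) :=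
      tendsto_div_zero_of_mul_le fun j => (Nat.mul_le_mul_left j (hM j)).trans (hnP j)
    simpa only [mul_zero, zero_add] using (hlim.const_mul (2 * C)).add_const (δ / 8)
  refine not_cauchySeq_of_dist_comp_le hT hdist (η := δ / 4) ?_ (by linarith)
  have hδ' : δ / 8 < δ / 4 := by linarith
  filter_upwards [hratio.eventually_le_const hδ', eventually_gt_atTop 0] with j hj hjpos
  refine (dist_cesaroMean_add_le (hjpos.trans (hn j)) (fun _ => hC _ trivial) fun i hi => ?_).trans
    hj
  exact (hφρ ((hshadow j hjpos i hi.le).trans_lt (hεr.trans_le (min_le_right _ _)))).le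

end IrregularSet

end FreeSemigroupAction

theorem theorem3_general {X Y E : Type*} [MetricSpace X] [CompactSpace X] [MeasurableSpace Y]
    [SeminormedAddCommGroup E] [NormedSpace ℝ E] [CompleteSpace E] (f : Y → X → X)
    (hf : ∀ y, Continuous (f y)) (hglue : FreeSemigroup.GluingOrbitProperty f)
    (ℙ : Measure (ℕ → Y)) (φ : X → E) (hφ : Continuous φ)
    (hne : (FreeSemigroup.irregularSet f φ).Nonempty) :
    FreeSemigroup.upperUmdim f ℙ (FreeSemigroup.irregularSet f φ) = FreeSemigroup.upperMdimM f ℙ ∧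
      FreeSemigroup.upperMdimM f ℙ = FreeSemigroup.upperUmdim f ℙ Set.univ := by
  have hdense := FreeSemigroupAction.dense_irregularSet hglue hf hφ hne
  exact ⟨FreeSemigroupAction.upperUmdim_eq_upperMdimM_of_dense hf hdense ℙ,
    (FreeSemigroupAction.upperUmdim_eq_upperMdimM_of_dense hf dense_univ ℙ).symm⟩

theorem theorem3 {X Y : Type*} [MetricSpace X] [CompactSpace X] [MetricSpace Y] [CompactSpace Y]
    [MeasurableSpace Y] [BorelSpace Y] (f : Y → X → X) (hf : ∀ y, Continuous (f y))
    (hglue : FreeSemigroup.GluingOrbitProperty f)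
    (hbox : FreeSemigroup.upperBoxDim Y < ⊤)
    (ν : Measure Y) [IsProbabilityMeasure ν]
    (hν : FreeSemigroup.IsHomogeneous ν) (hsupp : ν.support = Set.univ)
    (m : ℕ) (φ : X → EuclideanSpace ℝ (Fin m)) (hφ : Continuous φ)
    (hne : (FreeSemigroup.irregularSet f φ).Nonempty) :
    FreeSemigroup.upperUmdim f (FreeSemigroup.randomWalk ν) (FreeSemigroup.irregularSet f φ) =
        FreeSemigroup.upperMdimM f (FreeSemigroup.randomWalk ν) ∧
      FreeSemigroup.upperMdimM f (FreeSemigroup.randomWalk ν) =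
        FreeSemigroup.upperUmdim f (FreeSemigroup.randomWalk ν) Set.univ :=
  theorem3_general f hf hglue (FreeSemigroup.randomWalk ν) φ hφ hne
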